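/- For a positive integer $n$ write $n=(2a+1)2^{b+4c}$ with integers $a,b,c\ge 0$ and $0\le b<4$, and let $\rho(n)=8c+2^b$ (the Hurwitz–Radon function). The rank of a tensor $T=(t_{ijk})\in\mathbb{R}^{m\times n\times p}$ is the least integer $r\ge 0$ such that $T$ is a sum of $r$ tensors of the form $\mathbf a\otimes\mathbf b\otimes\mathbf c=(a_ib_jc_k)_{i,j,k}$ with $\mathbf a\in\mathbb{R}^m$, $\mathbf b\in\mathbb{R}^n$, $\mathbf c\in\mathbb{R}^p$. An integer $r$ is called a typical rank of $m\times n\times p$ tensors over $\mathbb{R}$ if there is a Lebesgue measurable set $S\subset\mathbb{R}^{m\times n\times p}$ of positive Lebesgue measure such that every $T\in S$ has rank $r$. Theorem. Let $m$, $n$ and $p$ be positive integers with $3\le m\le\rho(n)$ and $(m-1)(n-1)+1\le p\le (m-1)n$. Then there are at least two typical ranks of $m\times n\times p$ tensors over $\mathbb{R}$. Moreover, $p$ is a typical rank, and there is a typical rank larger than $p$. -/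

import Mathlib

open MeasureTheory

/-- The Hurwitz–Radon function: if `n = (2a+1) * 2^(b+4c)` with `0 ≤ b < 4`,
then `ρ(n) = 8c + 2^b`. Here `b + 4c` is the exponent of `2` in the positive integer `n`. -/
def hurwitzRadon (n : ℕ) : ℕ :=
  8 * (padicValNat 2 n / 4) + 2 ^ (padicValNat 2 n % 4)

/-- `hurwitzRadon` satisfies the defining formula of the Hurwitz–Radon function. -/
theorem hurwitzRadon_eq (a b c : ℕ) (hb : b < 4) :
    hurwitzRadon ((2 * a + 1) * 2 ^ (b + 4 * c)) = 8 * c + 2 ^ b := by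
  have h : padicValNat 2 ((2 * a + 1) * 2 ^ (b + 4 * c)) = b + 4 * c := by
    rw [padicValNat.mul (by omega) (by positivity), padicValNat.prime_pow,
      padicValNat.eq_zero_of_not_dvd (by omega), zero_add]
  unfold hurwitzRadon
  rw [h, show (b + 4 * c) / 4 = c by omega, show (b + 4 * c) % 4 = b by omega]

/-- The space of `m × n × p` tensors (three-dimensional arrays) over `K`.
For `K = ℝ` its `volume` is Lebesgue measure on `ℝ^(mnp)`. -/
abbrev Tensor3 (K : Type*) (m n p : ℕ) : Type _ := Fin m → Fin n → Fin p → K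

/-- The rank-one (or zero) tensor `a ⊗ b ⊗ c`, with entries `a i * b j * c k`. -/
def Tensor3.pure {K : Type*} [Field K] {m n p : ℕ}
    (a : Fin m → K) (b : Fin n → K) (c : Fin p → K) : Tensor3 K m n p :=
  fun i j k => a i * b j * c k

/-- `T` is a sum of `r` tensors of the form `a ⊗ b ⊗ c`. -/
def Tensor3.IsSumOfPure {K : Type*} [Field K] {m n p : ℕ} (T : Tensor3 K m n p) (r : ℕ) : Prop :=
  ∃ (a : Fin r → Fin m → K) (b : Fin r → Fin n → K) (c : Fin r → Fin p → K),
    T = ∑ u : Fin r, Tensor3.pure (a u) (b u) (c u)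

/-- Every tensor is a finite sum of tensors `a ⊗ b ⊗ c`, so the minimum defining the rank is
taken over a nonempty set. -/
theorem Tensor3.exists_isSumOfPure {K : Type*} [Field K] {m n p : ℕ} (T : Tensor3 K m n p) :
    ∃ r : ℕ, T.IsSumOfPure r := by
  classical
  let e := (Fintype.equivFin (Fin m × Fin n)).symm
  refine ⟨Fintype.card (Fin m × Fin n), fun u => Pi.single (e u).1 1,
    fun u => Pi.single (e u).2 1, fun u => T (e u).1 (e u).2, ?_⟩
  funext i j k
  simp only [Finset.sum_apply, Tensor3.pure]
  rw [e.sum_comp (fun x : Fin m × Fin n =>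
    (Pi.single x.1 (1 : K) : Fin m → K) i * (Pi.single x.2 (1 : K) : Fin n → K) j * T x.1 x.2 k),
    Fintype.sum_prod_type]
  simp [Pi.single_apply]

/-- The rank of a tensor: the least `r` such that it is a sum of `r` tensors `a ⊗ b ⊗ c`. -/
noncomputable def Tensor3.rank {K : Type*} [Field K] {m n p : ℕ} (T : Tensor3 K m n p) : ℕ :=
  sInf {r : ℕ | T.IsSumOfPure r}

/-- The set of typical ranks of real `m × n × p` tensors: the integers `r` such that
some (Lebesgue measurable) set of positive Lebesgue measure consists of tensors of rank `r`. -/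
def typicalRanks (m n p : ℕ) : Set ℕ :=
  {r : ℕ | ∃ S : Set (Tensor3 ℝ m n p),
    NullMeasurableSet S volume ∧ 0 < volume S ∧ ∀ T ∈ S, T.rank = r}

/-! Write `m = d + 1`, `n = e + 1`. Two disjoint nonempty open sets of tensors are found, and both
rest on one bound: if the `p` slices along the third index are linearly independent, the rank is at
least `p`, since a sum of `r` pure tensors has its slices in the span of `r` rank-one matrices.

Rank `p`: at `curvePoint`, whose slices are rank-one matrices over points `(t, t ^ d)` of a rational
curve, the slices are independent and the differential of `sumPure` is onto. Hence every nearby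
tensor is a sum of `p` pure tensors and has rank exactly `p`. Surjectivity is checked dually: a
functional killing the image gives, for each slice, a polynomial in `x, y` to which
`eq_zero_of_vanishing` applies. This is where `d * e + 1 ≤ p` enters.

Rank above `p`: Clifford families give a nonsingular bilinear map `ℝᵐ × ℝⁿ → ℝⁿ` for `m ≤ ρ(n)`. The
induced linear map on matrices has kernel of dimension at least `(m - 1) * n` and kills no rank-one
matrix. A tensor with independent slices in this kernel has rank above `p`, because at rank `p` the
slice span would contain the rank-one summands. The condition is open by compactness of the sphere,
and as ranks are countable, one of them has positive measure there. -/

open scoped Kronecker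

/-! ### Clifford families and nonsingular bilinear maps -/

/-- A family of matrices with `A i ^ 2 = -1` that pairwise anticommute. -/
structure IsCliffordFamily {κ ν : Type*} [Fintype ν] [DecidableEq ν]
    (A : κ → Matrix ν ν ℝ) : Prop where
  sq : ∀ i, A i * A i = -1
  anticomm : ∀ i j, i ≠ j → A i * A j = -(A j * A i)

namespace IsCliffordFamily

variable {κ κ' ν ν' : Type*} [Fintype ν] [DecidableEq ν] [Fintype ν'] [DecidableEq ν']

theorem comp_injective {A : κ → Matrix ν ν ℝ} (hA : IsCliffordFamily A) {f : κ' → κ}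
    (hf : Function.Injective f) : IsCliffordFamily (A ∘ f) :=
  ⟨fun _ => hA.sq _, fun _ _ h => hA.anticomm _ _ fun h' => h (hf h')⟩

theorem reindex {A : κ → Matrix ν ν ℝ} (hA : IsCliffordFamily A) (e : ν ≃ ν') :
    IsCliffordFamily fun i => (A i).submatrix e.symm e.symm := by
  constructor
  · intro i
    rw [Matrix.submatrix_mul_equiv, hA.sq, Matrix.submatrix_neg, Pi.neg_apply, Pi.neg_apply,
      Matrix.submatrix_one_equiv]
  · intro i j h
    rw [Matrix.submatrix_mul_equiv, Matrix.submatrix_mul_equiv, hA.anticomm i j h]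
    rfl

theorem kronecker_one {A : κ → Matrix ν ν ℝ} (hA : IsCliffordFamily A) :
    IsCliffordFamily fun i => A i ⊗ₖ (1 : Matrix ν' ν' ℝ) := by
  constructor
  · intro i
    rw [← Matrix.mul_kronecker_mul, hA.sq, one_mul, ← neg_one_smul ℝ (1 : Matrix ν ν ℝ),
      Matrix.smul_kronecker, Matrix.one_kronecker_one, neg_one_smul]
  · intro i j h
    rw [← Matrix.mul_kronecker_mul, ← Matrix.mul_kronecker_mul, hA.anticomm i j h,
      ← neg_one_smul ℝ, Matrix.smul_kronecker, neg_one_smul]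

/-- Tensoring a Clifford family with an involution anticommuting with another one. -/
theorem sumElim {A : κ → Matrix ν ν ℝ} {B : κ' → Matrix ν' ν' ℝ} (hA : IsCliffordFamily A)
    (hB : IsCliffordFamily B) {W : Matrix ν ν ℝ} (hW : W * W = 1)
    (hWA : ∀ i, A i * W = -(W * A i)) :
    IsCliffordFamily (Sum.elim (fun i => A i ⊗ₖ (1 : Matrix ν' ν' ℝ)) fun j => W ⊗ₖ B j) := by
  have hn : ∀ (X : Matrix ν ν ℝ) (Y : Matrix ν' ν' ℝ), (-X) ⊗ₖ Y = -(X ⊗ₖ Y) := fun X Y => by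
    rw [← neg_one_smul ℝ X, Matrix.smul_kronecker, neg_one_smul]
  have hn' : ∀ (X : Matrix ν ν ℝ) (Y : Matrix ν' ν' ℝ), X ⊗ₖ (-Y) = -(X ⊗ₖ Y) := fun X Y => by
    rw [← neg_one_smul ℝ Y, Matrix.kronecker_smul, neg_one_smul]
  constructor
  · rintro (i | i)
    · exact (hA.kronecker_one (ν' := ν')).sq i
    · simp only [Sum.elim_inr]
      rw [← Matrix.mul_kronecker_mul, hW, hB.sq, hn', Matrix.one_kronecker_one]
  · rintro (i | i) (j | j) h
    · exact (hA.kronecker_one (ν' := ν')).anticomm i j (by simpa using h)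
    · simp only [Sum.elim_inr, Sum.elim_inl]
      rw [← Matrix.mul_kronecker_mul, ← Matrix.mul_kronecker_mul, hWA, hn, one_mul, mul_one]
    · simp only [Sum.elim_inr, Sum.elim_inl]
      rw [← Matrix.mul_kronecker_mul, ← Matrix.mul_kronecker_mul, hWA, hn, one_mul, mul_one,
        neg_neg]
    · simp only [Sum.elim_inr]
      rw [← Matrix.mul_kronecker_mul, ← Matrix.mul_kronecker_mul,
        hB.anticomm i j (by simpa using h), hn']

/-- For a Clifford family, `x₀ + ∑ xᵢ Aᵢ` is injective unless `x = 0`. -/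
theorem eq_zero_of_mulVec_eq_zero [Fintype κ] [DecidableEq κ] {A : κ → Matrix ν ν ℝ}
    (hA : IsCliffordFamily A)
    (x₀ : ℝ) (x : κ → ℝ) (y : ν → ℝ) (hy : y ≠ 0)
    (h : (x₀ • (1 : Matrix ν ν ℝ) + ∑ i, x i • A i).mulVec y = 0) : x₀ = 0 ∧ x = 0 := by
  set S := ∑ i, x i • A i with hS
  have hSS : S * S = -(∑ i, x i ^ 2) • (1 : Matrix ν ν ℝ) := by
    have h1 : S * S = ∑ i, ∑ j, (x i * x j) • (A i * A j) := by
      simp only [hS, Finset.sum_mul, Finset.mul_sum, smul_mul_smul_comm]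
      exact Finset.sum_comm
    -- Symmetrizing in `i, j` cancels every off-diagonal term by anticommutation.
    have h2 : S * S + S * S = ∑ i, ∑ j, (x i * x j) • (A i * A j + A j * A i) := by
      simp only [smul_add, Finset.sum_add_distrib]
      congr 1
      rw [h1, Finset.sum_comm]
      simp only [mul_comm]
    have h3 : ∀ i, ∑ j, (x i * x j) • (A i * A j + A j * A i) =
        (-2 * x i ^ 2) • (1 : Matrix ν ν ℝ) := by
      intro i
      rw [Finset.sum_eq_single i]
      · rw [hA.sq, ← neg_one_smul ℝ (1 : Matrix ν ν ℝ), ← add_smul, smul_smul]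
        congr 1
        ring
      · intro j _ hj
        rw [hA.anticomm j i hj]
        simp
      · simp
    simp only [h3] at h2
    rw [← Finset.sum_smul, ← Finset.mul_sum, ← two_smul ℝ] at h2
    have h4 := congrArg (fun X => (1 / 2 : ℝ) • X) h2
    simp only [smul_smul] at h4
    norm_num at h4
    rw [h4, ← neg_smul]
    congr 1
    ring
  -- Multiplying by the conjugate gives a scalar, as for the complex norm.
  have h1 : (x₀ • (1 : Matrix ν ν ℝ) - S) * (x₀ • (1 : Matrix ν ν ℝ) + S) =
      (x₀ ^ 2 + ∑ i, x i ^ 2) • (1 : Matrix ν ν ℝ) := by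
    rw [sub_mul, mul_add, mul_add, hSS]
    simp only [smul_mul_assoc, one_mul, mul_smul_comm, mul_one, smul_smul]
    rw [add_smul, neg_smul, ← pow_two]
    abel
  have h2 : (x₀ ^ 2 + ∑ i, x i ^ 2) • y = 0 := by
    have := congrArg ((x₀ • (1 : Matrix ν ν ℝ) - S).mulVec) h
    rwa [Matrix.mulVec_mulVec, h1, Matrix.smul_mulVec, Matrix.one_mulVec, Matrix.mulVec_zero]
      at this
  have h3 := (smul_eq_zero.1 h2).resolve_right hy
  have h4 : 0 ≤ ∑ i, x i ^ 2 := Finset.sum_nonneg fun i _ => sq_nonneg _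
  have h5 : ∑ i, x i ^ 2 = 0 := by nlinarith [sq_nonneg x₀]
  refine ⟨by nlinarith, funext fun i => ?_⟩
  have := (Finset.sum_eq_zero_iff_of_nonneg fun i _ => sq_nonneg (x i)).1 h5 i (Finset.mem_univ i)
  simpa using this

end IsCliffordFamily

/-- There are `k` anticommuting complex structures on `ℝⁿ`. -/
def HasCliffordFamily (k n : ℕ) : Prop :=
  ∃ A : Fin k → Matrix (Fin n) (Fin n) ℝ, IsCliffordFamily A

theorem IsCliffordFamily.hasCliffordFamily {κ ν : Type*} [Fintype κ] [Fintype ν] [DecidableEq ν]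
    {A : κ → Matrix ν ν ℝ} (hA : IsCliffordFamily A) {k n : ℕ} (hk : k ≤ Fintype.card κ)
    (hn : Fintype.card ν = n) : HasCliffordFamily k n :=
  ⟨_, (hA.comp_injective ((Fintype.equivFin κ).symm.injective.comp
    (Fin.castLE_injective hk))).reindex (Fintype.equivFinOfCardEq hn)⟩

theorem HasCliffordFamily.mono {k k' n : ℕ} (h : HasCliffordFamily k n) (hk : k' ≤ k) :
    HasCliffordFamily k' n := by
  obtain ⟨A, hA⟩ := h
  exact hA.hasCliffordFamily (by simpa using hk) (by simp)

theorem HasCliffordFamily.mul {k n : ℕ} (h : HasCliffordFamily k n) (r : ℕ) :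
    HasCliffordFamily k (n * r) := by
  obtain ⟨A, hA⟩ := h
  exact (hA.kronecker_one (ν' := Fin r)).hasCliffordFamily (by simp) (by simp)

theorem isCliffordFamily_two :
    IsCliffordFamily fun _ : Unit => !![(0 : ℝ), -1; 1, 0] := by
  constructor
  · intro i
    ext i j
    fin_cases i <;> fin_cases j <;> simp [Matrix.mul_apply]
  · intro i j h
    exact absurd rfl h

/-- Left multiplication by the quaternion units. -/
def quaternionLeft : Fin 3 → Matrix (Fin 4) (Fin 4) ℝ :=
  ![!![0, -1, 0, 0; 1, 0, 0, 0; 0, 0, 0, -1; 0, 0, 1, 0],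
    !![0, 0, -1, 0; 0, 0, 0, 1; 1, 0, 0, 0; 0, -1, 0, 0],
    !![0, 0, 0, -1; 0, 0, -1, 0; 0, 1, 0, 0; 1, 0, 0, 0]]

/-- Right multiplication by the quaternion units. -/
def quaternionRight : Fin 3 → Matrix (Fin 4) (Fin 4) ℝ :=
  ![!![0, -1, 0, 0; 1, 0, 0, 0; 0, 0, 0, 1; 0, 0, -1, 0],
    !![0, 0, -1, 0; 0, 0, 0, -1; 1, 0, 0, 0; 0, 1, 0, 0],
    !![0, 0, 0, -1; 0, 0, 1, 0; 0, -1, 0, 0; 1, 0, 0, 0]]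

theorem isCliffordFamily_quaternionLeft : IsCliffordFamily quaternionLeft := by
  constructor
  · intro i
    fin_cases i <;> ext i j <;> fin_cases i <;> fin_cases j <;>
      simp [quaternionLeft, Matrix.mul_apply, Fin.sum_univ_four]
  · intro i j h
    fin_cases i <;> fin_cases j <;> first
      | exact absurd rfl h
      | ext i j
        fin_cases i <;> fin_cases j <;>
          simp [quaternionLeft, Matrix.mul_apply, Fin.sum_univ_four]

theorem isCliffordFamily_quaternionRight : IsCliffordFamily quaternionRight := by
  constructor
  · intro i
    fin_cases i <;> ext i j <;> fin_cases i <;> fin_cases j <;>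
      simp [quaternionRight, Matrix.mul_apply, Fin.sum_univ_four]
  · intro i j h
    fin_cases i <;> fin_cases j <;> first
      | exact absurd rfl h
      | ext i j
        fin_cases i <;> fin_cases j <;>
          simp [quaternionRight, Matrix.mul_apply, Fin.sum_univ_four]

/-- This is associativity of quaternion multiplication. -/
theorem commute_quaternionLeft_quaternionRight (i j : Fin 3) :
    quaternionLeft i * quaternionRight j = quaternionRight j * quaternionLeft i := by
  fin_cases i <;> fin_cases j <;> ext i j <;> fin_cases i <;> fin_cases j <;>
    simp [quaternionLeft, quaternionRight, Matrix.mul_apply, Fin.sum_univ_four]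

theorem pauli_relations :
    (!![0, 1; 1, 0] * !![0, 1; 1, 0] : Matrix (Fin 2) (Fin 2) ℝ) = 1 ∧
    (!![1, 0; 0, -1] * !![1, 0; 0, -1] : Matrix (Fin 2) (Fin 2) ℝ) = 1 ∧
    (!![0, -1; 1, 0] * !![0, -1; 1, 0] : Matrix (Fin 2) (Fin 2) ℝ) = -1 ∧
    (!![0, 1; 1, 0] * !![1, 0; 0, -1] : Matrix (Fin 2) (Fin 2) ℝ) =
      -(!![1, 0; 0, -1] * !![0, 1; 1, 0]) ∧
    (!![0, -1; 1, 0] * !![1, 0; 0, -1] : Matrix (Fin 2) (Fin 2) ℝ) =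
      -(!![1, 0; 0, -1] * !![0, -1; 1, 0]) ∧
    (!![0, -1; 1, 0] * !![0, 1; 1, 0] : Matrix (Fin 2) (Fin 2) ℝ) =
      -(!![0, 1; 1, 0] * !![0, -1; 1, 0]) := by
  refine ⟨?_, ?_, ?_, ?_, ?_, ?_⟩ <;> ext i j <;> fin_cases i <;> fin_cases j <;>
    simp [Matrix.mul_apply]

/-- The left units are tensored with `t`, the right units with `s`, and `1` with `e`. Left and right
units commute, while `s, t, e` anticommute pairwise, with `s² = t² = 1` and `e² = -1`; so all seven
products anticommute and square to `-1`. -/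
theorem exists_isCliffordFamily_eight :
    ∃ A : Fin 3 ⊕ Fin 3 ⊕ Unit → Matrix (Fin 4 × Fin 2) (Fin 4 × Fin 2) ℝ,
      IsCliffordFamily A := by
  obtain ⟨hs, ht, he, hst, het, hes⟩ := pauli_relations
  generalize (!![0, 1; 1, 0] : Matrix (Fin 2) (Fin 2) ℝ) = s at *
  generalize (!![1, 0; 0, -1] : Matrix (Fin 2) (Fin 2) ℝ) = t at *
  generalize (!![0, -1; 1, 0] : Matrix (Fin 2) (Fin 2) ℝ) = e at *
  have hn : ∀ (X : Matrix (Fin 4) (Fin 4) ℝ) (Y : Matrix (Fin 2) (Fin 2) ℝ),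
      (-X) ⊗ₖ Y = -(X ⊗ₖ Y) := fun X Y => by
    rw [← neg_one_smul ℝ X, Matrix.smul_kronecker, neg_one_smul]
  have hn' : ∀ (X : Matrix (Fin 4) (Fin 4) ℝ) (Y : Matrix (Fin 2) (Fin 2) ℝ),
      X ⊗ₖ (-Y) = -(X ⊗ₖ Y) := fun X Y => by
    rw [← neg_one_smul ℝ Y, Matrix.kronecker_smul, neg_one_smul]
  have hL := isCliffordFamily_quaternionLeft
  have hR := isCliffordFamily_quaternionRight
  have hLR := commute_quaternionLeft_quaternionRight
  refine ⟨Sum.elim (fun i => quaternionLeft i ⊗ₖ t)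
    (Sum.elim (fun i => quaternionRight i ⊗ₖ s) fun _ => 1 ⊗ₖ e), ?_, ?_⟩
  · rintro (i | i | i) <;>
      simp only [Sum.elim_inr, Sum.elim_inl, ← Matrix.mul_kronecker_mul, hL.sq, hR.sq, hs, ht, he,
      hn, hn', Matrix.one_kronecker_one, one_mul]
  · rintro (i | i | i) (j | j | j) h <;>
      simp only [Sum.elim_inr, Sum.elim_inl, ← Matrix.mul_kronecker_mul]
    · rw [hL.anticomm i j (by simpa using h), hn]
    · rw [hLR, hst, hn', neg_neg]
    · rw [one_mul, mul_one, het, hn', neg_neg]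
    · rw [hLR, hst, hn']
    · rw [hR.anticomm i j (by simpa using h), hn]
    · rw [one_mul, mul_one, hes, hn', neg_neg]
    · rw [one_mul, mul_one, het, hn']
    · rw [one_mul, mul_one, hes, hn']
    · exact absurd rfl h

/-- Eight structures `e ⊗ 1` and `s ⊗ A j` on `ℝ¹⁶` all anticommute with the involution `t ⊗ 1`, so
`sumElim` applies a second time, now with the given family. -/
theorem HasCliffordFamily.add_eight {k n : ℕ} (h : HasCliffordFamily k n) :
    HasCliffordFamily (k + 8) (n * 16) := by
  obtain ⟨B, hB⟩ := h
  obtain ⟨A, hA⟩ := exists_isCliffordFamily_eight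
  obtain ⟨hs, ht, he, hst, het, hes⟩ := pauli_relations
  have hE : IsCliffordFamily fun _ : Unit => !![(0 : ℝ), -1; 1, 0] := isCliffordFamily_two
  have hA' := hE.sumElim hA hs fun _ => hes
  have hW : ∀ i, (Sum.elim (fun _ : Unit => !![(0 : ℝ), -1; 1, 0] ⊗ₖ 1)
      (fun j => !![(0 : ℝ), 1; 1, 0] ⊗ₖ A j) i) * (!![(1 : ℝ), 0; 0, -1] ⊗ₖ 1) =
      -((!![(1 : ℝ), 0; 0, -1] ⊗ₖ 1) * (Sum.elim (fun _ : Unit => !![(0 : ℝ), -1; 1, 0] ⊗ₖ 1)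
      (fun j => !![(0 : ℝ), 1; 1, 0] ⊗ₖ A j) i)) := by
    rintro (i | i) <;>
      simp only [Sum.elim_inr, Sum.elim_inl, ← Matrix.mul_kronecker_mul, het, hst,
        one_mul, mul_one] <;>
      rw [← neg_one_smul ℝ, Matrix.smul_kronecker, neg_one_smul]
  exact (hA'.sumElim hB (W := !![(1 : ℝ), 0; 0, -1] ⊗ₖ 1)
    (by rw [← Matrix.mul_kronecker_mul, ht, one_mul, Matrix.one_kronecker_one]) hW
    ).hasCliffordFamily (by simp; omega) (by simp; omega)

/-- The base cases have 0, 1, 3, 7 structures in dimensions 1, 2, 4, 8; periodicity does the rest.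
-/
theorem hasCliffordFamily_two_pow (b c : ℕ) (hb : b < 4) :
    HasCliffordFamily (8 * c + 2 ^ b - 1) (2 ^ (b + 4 * c)) := by
  induction c with
  | zero =>
    interval_cases b
    · exact ⟨fun i => i.elim0, fun i => i.elim0, fun i => i.elim0⟩
    · exact isCliffordFamily_two.hasCliffordFamily (by simp) (by simp)
    · exact isCliffordFamily_quaternionLeft.hasCliffordFamily (by simp) (by simp)
    · obtain ⟨A, hA⟩ := exists_isCliffordFamily_eight
      exact hA.hasCliffordFamily (by simp) (by simp)
  | succ c ih =>
    have h1 : 8 * (c + 1) + 2 ^ b - 1 = (8 * c + 2 ^ b - 1) + 8 := by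
      have := Nat.one_le_two_pow (n := b)
      omega
    have h2 : 2 ^ (b + 4 * (c + 1)) = 2 ^ (b + 4 * c) * 16 := by ring
    rw [h1, h2]
    exact ih.add_eight

theorem hasCliffordFamily_hurwitzRadon (n : ℕ) :
    HasCliffordFamily (hurwitzRadon n - 1) n := by
  obtain ⟨r, hr⟩ : 2 ^ padicValNat 2 n ∣ n := pow_padicValNat_dvd
  have h := (hasCliffordFamily_two_pow (padicValNat 2 n % 4) (padicValNat 2 n / 4)
    (Nat.mod_lt _ (by norm_num))).mul r
  rwa [Nat.mod_add_div, ← hr] at h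

/-- A bilinear map `ℝᵐ × ℝⁿ → ℝⁿ` without zero divisors exists for `m ≤ ρ(n)`. -/
theorem exists_nonsingular_bilinear {m n : ℕ} (hm : 0 < m)
    (hmn : m ≤ hurwitzRadon n) :
    ∃ B : Fin m → Matrix (Fin n) (Fin n) ℝ, ∀ (x : Fin m → ℝ) (y : Fin n → ℝ),
      (∑ i, x i • B i).mulVec y = 0 → x = 0 ∨ y = 0 := by
  obtain ⟨d, rfl⟩ : ∃ d, m = d + 1 := ⟨m - 1, by omega⟩
  obtain ⟨A, hA⟩ := (hasCliffordFamily_hurwitzRadon n).mono (k' := d) (by omega)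
  -- The identity together with `m - 1` complex structures.
  refine ⟨Fin.cons 1 A, fun x y h => or_iff_not_imp_right.2 fun hy => ?_⟩
  rw [Fin.sum_univ_succ] at h
  simp only [Fin.cons_zero, Fin.cons_succ] at h
  obtain ⟨h0, h1⟩ := hA.eq_zero_of_mulVec_eq_zero (x 0) (fun i => x i.succ) y hy h
  funext i
  refine Fin.cases h0 (fun i => congrFun h1 i) i

/-! ### Vanishing of polynomials at points of a curve -/

/-- Division of `∑ vⱼ yʲ` by `y - s` when `s` is a root. -/
theorem exists_sum_pow_eq_sub_mul {n : ℕ} (v : Fin (n + 1) → ℝ) (s : ℝ)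
    (h : ∑ j, v j * s ^ (j : ℕ) = 0) :
    ∃ r : Fin n → ℝ, ∀ y, ∑ j, v j * y ^ (j : ℕ) = (y - s) * ∑ j, r j * y ^ (j : ℕ) := by
  induction n with
  | zero =>
    refine ⟨fun _ => 0, fun y => ?_⟩
    simpa using h
  | succ n ih =>
    have key : ∀ y : ℝ, ∑ j, v j * y ^ (j : ℕ) = v (Fin.last _) * y ^ n * (y - s) +
        ∑ j : Fin (n + 1), (v j.castSucc + if j = Fin.last n then s * v (Fin.last _) else 0) *
          y ^ (j : ℕ) := by
      intro y
      rw [Fin.sum_univ_castSucc]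
      simp only [add_mul, ite_mul, zero_mul, Finset.sum_add_distrib, Finset.sum_ite_eq',
        Finset.mem_univ, if_true, Fin.val_castSucc, Fin.val_last]
      ring
    obtain ⟨r, hr⟩ := ih
      (fun j => v j.castSucc + if j = Fin.last n then s * v (Fin.last _) else 0)
      (by have := key s; rw [h] at this; simpa using this.symm)
    refine ⟨Fin.snoc r (v (Fin.last _)), fun y => ?_⟩
    rw [key y, hr y, Fin.sum_univ_castSucc]
    simp only [Fin.snoc_castSucc, Fin.snoc_last, Fin.val_castSucc, Fin.val_last]
    ring

/-- A polynomial of degree `< N` vanishing at `N` distinct points has zero coefficients. -/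
theorem eq_zero_of_sum_pow_eq_zero {ι : Type*} {N : ℕ} (v : Fin N → ℝ) (s : Finset ι)
    (t : ι → ℝ) (ht : Set.InjOn t s) (hs : N ≤ s.card)
    (h : ∀ u ∈ s, ∑ l, v l * t u ^ (l : ℕ) = 0) : v = 0 := by
  obtain ⟨s', hs', hc⟩ := Finset.exists_subset_card_eq hs
  refine Matrix.eq_zero_of_forall_index_sum_mul_pow_eq_zero
    (f := fun l => t ((s'.equivFinOfCardEq hc).symm l)) ?_ fun j => h _ (hs' (Subtype.coe_prop _))
  intro i j hij
  exact (s'.equivFinOfCardEq hc).symm.injective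
    (Subtype.ext (ht (hs' (Subtype.coe_prop _)) (hs' (Subtype.coe_prop _)) hij))

/-- A form `∑ rᵢⱼ xⁱ yʲ` with `i < d`, `j < e` vanishing at `d * e` points `(t, t ^ d)` is zero. -/
theorem eq_zero_of_sum_pow_pow_eq_zero {ι : Type*} {d e : ℕ} (r : Fin d → Fin e → ℝ)
    (s : Finset ι) (t : ι → ℝ) (ht : Set.InjOn t s) (hs : d * e ≤ s.card)
    (h : ∀ u ∈ s, ∑ i, ∑ j, r i j * t u ^ (i : ℕ) * (t u ^ d) ^ (j : ℕ) = 0) : r = 0 := by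
  -- On `y = x ^ d` the exponents `i + d * j` with `i < d` are distinct and below `d * e`.
  have h0 := eq_zero_of_sum_pow_eq_zero
    (fun l : Fin (e * d) => r (finProdFinEquiv.symm l).2 (finProdFinEquiv.symm l).1) s t ht
    (by rwa [mul_comm]) (fun u hu => by
      rw [← h u hu, Finset.sum_comm, ← Fintype.sum_prod_type', ← finProdFinEquiv.sum_comp]
      refine Finset.sum_congr rfl fun x _ => ?_
      rw [Equiv.symm_apply_apply, finProdFinEquiv_apply_val, pow_add, pow_mul, mul_assoc])
  funext i j
  simpa using congrFun h0 (finProdFinEquiv (j, i))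

/-- A bilinear form killed by `(tᵢ)` on the left and by `(sⱼ)` on the right, vanishing at
sufficiently many further points, is zero. -/
theorem eq_zero_of_vanishing {ι : Type*} [Fintype ι] [DecidableEq ι] {d e : ℕ}
    (M : Fin (d + 1) → Fin (e + 1) → ℝ)
    (t : ι → ℝ) (ht : Function.Injective t) (htd : Function.Injective fun u => t u ^ d)
    (k : ι) (hcard : d * e + 1 ≤ Fintype.card ι)
    (h1 : ∀ j, ∑ i, M i j * t k ^ (i : ℕ) = 0)
    (h2 : ∀ i, ∑ j, M i j * (t k ^ d) ^ (j : ℕ) = 0)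
    (h3 : ∀ u, ∑ i, ∑ j, M i j * t u ^ (i : ℕ) * (t u ^ d) ^ (j : ℕ) = 0) : M = 0 := by
  choose q hq using fun j => exists_sum_pow_eq_sub_mul (fun i => M i j) (t k) (h1 j)
  have hq0 : ∀ i, ∑ j, q j i * (t k ^ d) ^ (j : ℕ) = 0 := by
    -- The points `t k + l + 1` are any `d` values other than `t k`, so that the factor `x - t k`
    -- can be cancelled.
    refine fun i => congrFun (eq_zero_of_sum_pow_eq_zero
      (fun i : Fin d => ∑ j, q j i * (t k ^ d) ^ (j : ℕ)) (Finset.range d)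
      (fun l => t k + l + 1) (fun a _ b _ hab => by simpa using hab) (by simp) fun l _ => ?_) i
    have h4 : (((l : ℝ) + 1)) * ∑ i : Fin d, (∑ j, q j i * (t k ^ d) ^ (j : ℕ)) *
        (t k + l + 1) ^ (i : ℕ) = 0 := by
      have h5 : ∑ j : Fin (e + 1), (∑ i, M i j * (t k + l + 1) ^ (i : ℕ)) *
          (t k ^ d) ^ (j : ℕ) = 0 := by
        simp only [Finset.sum_mul]
        rw [Finset.sum_comm]
        refine Finset.sum_eq_zero fun i _ => ?_
        rw [← zero_mul ((t k + l + 1) ^ (i : ℕ)), ← h2 i, Finset.sum_mul]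
        exact Finset.sum_congr rfl fun j _ => by ring
      rw [← h5]
      simp only [hq, Finset.sum_mul, Finset.mul_sum]
      rw [Finset.sum_comm]
      exact Finset.sum_congr rfl fun j _ => Finset.sum_congr rfl fun i _ => by ring
    exact (mul_eq_zero.1 h4).resolve_left (by positivity)
  choose r hr using fun i => exists_sum_pow_eq_sub_mul (fun j => q j i) (t k ^ d) (hq0 i)
  have key : ∀ x y : ℝ, ∑ i, ∑ j, M i j * x ^ (i : ℕ) * y ^ (j : ℕ) =
      (x - t k) * (y - t k ^ d) * ∑ i, ∑ j, r i j * x ^ (i : ℕ) * y ^ (j : ℕ) := by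
    intro x y
    calc _ = ∑ j, (∑ i, M i j * x ^ (i : ℕ)) * y ^ (j : ℕ) := by
          rw [Finset.sum_comm]
          simp only [Finset.sum_mul]
      _ = (x - t k) * ∑ i, (∑ j, q j i * y ^ (j : ℕ)) * x ^ (i : ℕ) := by
          simp only [hq, Finset.sum_mul, Finset.mul_sum]
          rw [Finset.sum_comm]
          exact Finset.sum_congr rfl fun j _ => Finset.sum_congr rfl fun i _ => by ring
      _ = _ := by
          simp only [hr, Finset.sum_mul, Finset.mul_sum]
          exact Finset.sum_congr rfl fun j _ => Finset.sum_congr rfl fun i _ => by ring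
  -- The quotient by `(x - t k) * (y - t k ^ d)` still vanishes at the at least `d * e` points other
  -- than `k`.
  have hr0 : r = 0 := by
    refine eq_zero_of_sum_pow_pow_eq_zero r (Finset.univ.erase k) t ht.injOn ?_ fun u hu => ?_
    · rw [Finset.card_erase_of_mem (Finset.mem_univ k), Finset.card_univ]
      omega
    · have h4 := h3 u
      rw [key] at h4
      have hne := Finset.ne_of_mem_erase hu
      exact (mul_eq_zero.1 h4).resolve_left
        (mul_ne_zero (sub_ne_zero.2 (ht.ne hne)) (sub_ne_zero.2 (htd.ne hne)))
  have hP : ∀ x y : ℝ, ∑ i, ∑ j, M i j * x ^ (i : ℕ) * y ^ (j : ℕ) = 0 := by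
    intro x y
    rw [key, hr0]
    simp
  refine eq_zero_of_sum_pow_pow_eq_zero M (Finset.range ((d + 1) * (e + 1))) (fun l => (l : ℝ))
    (fun a _ b _ hab => by simpa using hab) (by simp) fun u _ => hP _ _

/-! ### Sums of pure tensors, measurability and slices -/

/-- The sum of the tensors `a u ⊗ b u ⊗ c u`. -/
noncomputable def Tensor3.sumPure {m n p r : ℕ}
    (x : (Fin r → Fin m → ℝ) × (Fin r → Fin n → ℝ) × (Fin r → Fin p → ℝ)) : Tensor3 ℝ m n p :=
  ∑ u, Tensor3.pure (x.1 u) (x.2.1 u) (x.2.2 u)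

namespace Tensor3

variable {m n p r : ℕ}

theorem sumPure_apply
    (x : (Fin r → Fin m → ℝ) × (Fin r → Fin n → ℝ) × (Fin r → Fin p → ℝ)) (i j k) :
    sumPure x i j k = ∑ u, x.1 u i * x.2.1 u j * x.2.2 u k := by
  simp [sumPure, Tensor3.pure, Finset.sum_apply]

theorem setOf_isSumOfPure (m n p r : ℕ) :
    {T : Tensor3 ℝ m n p | T.IsSumOfPure r} = Set.range (sumPure (r := r)) := by
  ext T
  constructor
  · rintro ⟨a, b, c, rfl⟩
    exact ⟨(a, b, c), rfl⟩
  · rintro ⟨x, rfl⟩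
    exact ⟨x.1, x.2.1, x.2.2, rfl⟩

theorem contDiff_sumPure :
    ContDiff ℝ 1 (sumPure : (Fin r → Fin m → ℝ) × (Fin r → Fin n → ℝ) × (Fin r → Fin p → ℝ) →
      Tensor3 ℝ m n p) := by
  refine contDiff_pi.2 fun i => contDiff_pi.2 fun j => contDiff_pi.2 fun k => ?_
  simp only [sumPure_apply]
  fun_prop

/-- A continuous image of a σ-compact space is a countable union of compact sets. -/
theorem measurableSet_isSumOfPure (m n p r : ℕ) :
    MeasurableSet {T : Tensor3 ℝ m n p | T.IsSumOfPure r} := by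
  rw [setOf_isSumOfPure]
  obtain ⟨K, hK, hU⟩ := isSigmaCompact_range
    (contDiff_sumPure (m := m) (n := n) (p := p) (r := r)).continuous
  rw [← hU]
  exact MeasurableSet.iUnion fun i => (hK i).measurableSet

theorem rank_eq_iff (T : Tensor3 ℝ m n p) (r : ℕ) :
    T.rank = r ↔ T.IsSumOfPure r ∧ ∀ s < r, ¬ T.IsSumOfPure s := by
  constructor
  · rintro rfl
    exact ⟨Nat.sInf_mem T.exists_isSumOfPure, fun s hs => Nat.notMem_of_lt_sInf hs⟩
  · rintro ⟨h, h'⟩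
    refine le_antisymm (Nat.sInf_le h) (le_csInf ⟨r, h⟩ fun s hs => ?_)
    by_contra hlt
    exact h' s (not_le.1 hlt) hs

theorem measurableSet_rank_eq (m n p r : ℕ) :
    MeasurableSet {T : Tensor3 ℝ m n p | T.rank = r} := by
  simp only [rank_eq_iff]
  have : {T : Tensor3 ℝ m n p | ∀ s < r, ¬ T.IsSumOfPure s} =
      ⋂ s, ⋂ (_ : s < r), {T : Tensor3 ℝ m n p | T.IsSumOfPure s}ᶜ := by
    ext T
    simp
  rw [Set.ofPred_and, this]
  exact (measurableSet_isSumOfPure m n p r).inter <|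
    MeasurableSet.iInter fun s => MeasurableSet.iInter fun _ =>
    (measurableSet_isSumOfPure m n p s).compl

/-- The slices of a tensor along the third index. -/
def slice (T : Tensor3 ℝ m n p) (k : Fin p) : Fin m → Fin n → ℝ := fun i j => T i j k

theorem continuous_slice : Continuous (slice : Tensor3 ℝ m n p → _) := by
  unfold slice
  fun_prop

theorem IsSumOfPure.span_slice_le {T : Tensor3 ℝ m n p} (h : T.IsSumOfPure r) :
    ∃ (a : Fin r → Fin m → ℝ) (b : Fin r → Fin n → ℝ),
      Submodule.span ℝ (Set.range T.slice) ≤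
        Submodule.span ℝ (Set.range fun u i j => a u i * b u j) := by
  obtain ⟨a, b, c, rfl⟩ := h
  refine ⟨a, b, Submodule.span_le.2 ?_⟩
  rintro _ ⟨k, rfl⟩
  have : slice (∑ u, Tensor3.pure (a u) (b u) (c u)) k =
      ∑ u, c u k • fun i j => a u i * b u j := by
    funext i j
    simp only [slice, Finset.sum_apply, Tensor3.pure, Pi.smul_apply, smul_eq_mul]
    exact Finset.sum_congr rfl fun u _ => mul_comm _ _
  rw [this]
  exact Submodule.sum_mem _ fun u _ => Submodule.smul_mem _ _ (Submodule.subset_span ⟨u, rfl⟩)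

theorem IsSumOfPure.le_of_linearIndependent {T : Tensor3 ℝ m n p} (h : T.IsSumOfPure r)
    (hT : LinearIndependent ℝ T.slice) : p ≤ r := by
  obtain ⟨a, b, hle⟩ := h.span_slice_le
  have h1 := Submodule.finrank_mono hle
  rw [finrank_span_eq_card hT, Fintype.card_fin] at h1
  exact h1.trans ((finrank_range_le_card _).trans_eq (Fintype.card_fin r))

theorem isOpen_linearIndependent_slice (m n p : ℕ) :
    IsOpen {T : Tensor3 ℝ m n p | LinearIndependent ℝ T.slice} :=
  isOpen_setOfPred_linearIndependent.preimage continuous_slice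

/-! ### The differential and the slices at the base point -/

/-- A linear functional on tensors is given by a tensor of coefficients. -/
theorem functional_apply (f : Tensor3 ℝ m n p →ₗ[ℝ] ℝ) (T : Tensor3 ℝ m n p) :
    f T = ∑ i, ∑ j, ∑ k, T i j k * f (Pi.single i (Pi.single j (Pi.single k 1))) := by
  have : T = ∑ i, ∑ j, ∑ k, T i j k •
      (Pi.single i (Pi.single j (Pi.single k 1)) : Tensor3 ℝ m n p) := by
    funext i j k
    simp only [Finset.sum_apply, Pi.smul_apply, smul_eq_mul]
    rw [Finset.sum_eq_single i (fun i' _ h => by simp [Ne.symm h]) (by simp)]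
    rw [Finset.sum_eq_single j (fun i' _ h => by simp [Ne.symm h]) (by simp)]
    rw [Finset.sum_eq_single k (fun i' _ h => by simp [Ne.symm h]) (by simp)]
    simp
  conv_lhs => rw [this]
  simp

/-- `sumPure` is multilinear in the factors, so it is affine along any line moving only one kind of
factor, and its derivative there is the slope. -/
theorem fderiv_sumPure_of_affine
    {x v : (Fin r → Fin m → ℝ) × (Fin r → Fin n → ℝ) × (Fin r → Fin p → ℝ)}
    {w : Tensor3 ℝ m n p} (h : ∀ s : ℝ, sumPure (x + s • v) = sumPure x + s • w) :
    fderiv ℝ sumPure x v = w := by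
  have h1 := (contDiff_sumPure (m := m) (n := n) (p := p) (r := r)).differentiable one_ne_zero x
  have h2 := h1.hasFDerivAt.hasLineDerivAt v
  refine h2.unique ?_
  unfold HasLineDerivAt
  simp only [h]
  simpa using ((hasDerivAt_id (0 : ℝ)).smul_const w).const_add (sumPure x)

/-- The base point: the rank-one terms lie over the points `(t, t ^ d)` of a rational curve. -/
def curvePoint (d n p : ℕ) (t : Fin p → ℝ) :
    (Fin p → Fin (d + 1) → ℝ) × (Fin p → Fin n → ℝ) × (Fin p → Fin p → ℝ) :=
  (fun u i => t u ^ (i : ℕ), fun u j => (t u ^ d) ^ (j : ℕ), fun u => Pi.single u 1)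

/-- Moving the second, first and third factors gives `h1`, `h2` and `h3`, which are the hypotheses
of `eq_zero_of_vanishing` for each slice of an annihilating functional. -/
theorem range_fderiv_sumPure_curvePoint {d e : ℕ} {t : Fin p → ℝ} (ht : Function.Injective t)
    (htd : Function.Injective fun u => t u ^ d) (hp : d * e + 1 ≤ p) :
    (fderiv ℝ sumPure (curvePoint d (e + 1) p t) :
      _ →L[ℝ] Tensor3 ℝ (d + 1) (e + 1) p).range = ⊤ := by
  by_contra hne
  obtain ⟨f, hf0, hf⟩ := Submodule.exists_le_ker_of_lt_top _ (lt_top_iff_ne_top.2 hne)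
  set M : Fin (d + 1) → Fin (e + 1) → Fin p → ℝ :=
    fun i j k => f (Pi.single i (Pi.single j (Pi.single k 1))) with hM
  have hfM : ∀ T : Tensor3 ℝ (d + 1) (e + 1) p, f T = ∑ i, ∑ j, ∑ k, T i j k * M i j k :=
    functional_apply f
  have hw : ∀ {v : (Fin p → Fin (d + 1) → ℝ) × (Fin p → Fin (e + 1) → ℝ) × (Fin p → Fin p → ℝ)}
      {w : Tensor3 ℝ (d + 1) (e + 1) p},
      (∀ s : ℝ, sumPure (curvePoint d (e + 1) p t + s • v) =
        sumPure (curvePoint d (e + 1) p t) + s • w) →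
      ∑ i, ∑ j, ∑ k, w i j k * M i j k = 0 := by
    intro v w h
    rw [← hfM, ← fderiv_sumPure_of_affine h]
    exact hf ⟨v, rfl⟩
  have h1 : ∀ k j, ∑ i, M i j k * t k ^ (i : ℕ) = 0 := by
    intro k j
    have := hw (v := (0, Pi.single k (Pi.single j 1), 0))
      (w := fun i j' k' => t k ^ (i : ℕ) * (Pi.single j 1 : Fin (e + 1) → ℝ) j' *
        (Pi.single k 1 : Fin p → ℝ) k') (fun s => by
      funext i' j' k'
      simp only [sumPure_apply, curvePoint, Prod.fst_add, Prod.snd_add, Prod.smul_fst,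
        Prod.smul_snd, Pi.add_apply, Pi.smul_apply, smul_eq_mul, Pi.zero_apply, mul_zero, add_zero,
        mul_add, add_mul, Finset.sum_add_distrib]
      congr 1
      rw [Finset.sum_eq_single k (fun u _ h => by simp [h]) (by simp)]
      simp only [Pi.single_eq_same]
      ring)
    simpa [Pi.single_apply, mul_comm] using this
  have h2 : ∀ k i, ∑ j, M i j k * (t k ^ d) ^ (j : ℕ) = 0 := by
    intro k i
    have := hw (v := (Pi.single k (Pi.single i 1), 0, 0))
      (w := fun i' j k' => (Pi.single i 1 : Fin (d + 1) → ℝ) i' * (t k ^ d) ^ (j : ℕ) *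
        (Pi.single k 1 : Fin p → ℝ) k') (fun s => by
      funext i' j' k'
      simp only [sumPure_apply, curvePoint, Prod.fst_add, Prod.snd_add, Prod.smul_fst,
        Prod.smul_snd, Pi.add_apply, Pi.smul_apply, smul_eq_mul, Pi.zero_apply, mul_zero, add_zero,
        add_mul, Finset.sum_add_distrib]
      congr 1
      rw [Finset.sum_eq_single k (fun u _ h => by simp [h]) (by simp)]
      simp only [Pi.single_eq_same]
      ring)
    simpa [Pi.single_apply, mul_comm] using this
  have h3 : ∀ k u, ∑ i, ∑ j, M i j k * t u ^ (i : ℕ) * (t u ^ d) ^ (j : ℕ) = 0 := by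
    intro k u
    have := hw (v := (0, 0, Pi.single u (Pi.single k 1)))
      (w := fun i' j' k' => t u ^ (i' : ℕ) * (t u ^ d) ^ (j' : ℕ) *
        (Pi.single k 1 : Fin p → ℝ) k') (fun s => by
      funext i' j' k'
      simp only [sumPure_apply, curvePoint, Prod.fst_add, Prod.snd_add, Prod.smul_fst,
        Prod.smul_snd, Pi.add_apply, Pi.smul_apply, smul_eq_mul, Pi.zero_apply, mul_zero, add_zero,
        mul_add, Finset.sum_add_distrib]
      congr 1
      rw [Finset.sum_eq_single u (fun u _ h => by simp [h]) (by simp)]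
      simp only [Pi.single_eq_same]
      ring)
    rw [← this]
    refine Finset.sum_congr rfl fun i _ => Finset.sum_congr rfl fun j _ => ?_
    rw [Finset.sum_eq_single k (fun u _ h => by simp [h]) (by simp), Pi.single_eq_same]
    ring
  have hM0 : ∀ k, (fun i j => M i j k) = 0 := fun k =>
    eq_zero_of_vanishing (fun i j => M i j k) t ht htd k (by simpa using hp) (h1 k) (h2 k) (h3 k)
  refine hf0 (LinearMap.ext fun T => ?_)
  rw [hfM]
  have hM0' : ∀ i j k, M i j k = 0 := fun i j k => congrFun (congrFun (hM0 k) i) j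
  simp [hM0']

/-- The entries of slice `k` include `t k ^ l` for all `l < d * n`, with `l % d` and `l / d` as row
and column, so a Vandermonde argument applies. -/
theorem linearIndependent_slice_curvePoint {d n : ℕ} {t : Fin p → ℝ}
    (ht : Function.Injective t) (hp : p ≤ d * n) :
    LinearIndependent ℝ (slice (sumPure (curvePoint d n p t))) := by
  rw [Fintype.linearIndependent_iff]
  intro g hg
  have hs : ∀ k i j, slice (sumPure (curvePoint d n p t)) k i j =
      t k ^ (i : ℕ) * (t k ^ d) ^ (j : ℕ) := by
    intro k i j
    rw [slice, sumPure_apply, Finset.sum_eq_single k _ (by simp)]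
    · simp [curvePoint]
    · intro u _ hu
      simp [curvePoint, hu.symm]
  refine fun k => congrFun (Matrix.eq_zero_of_forall_pow_sum_mul_pow_eq_zero ht fun l => ?_) k
  have hl : (l : ℕ) < d * n := l.2.trans_le hp
  have hd : 0 < d := Nat.pos_of_mul_pos_right (Nat.zero_lt_of_lt hl)
  have := congrFun (congrFun hg ⟨l % d, (Nat.mod_lt _ hd).trans d.lt_succ_self⟩)
    ⟨l / d, Nat.div_lt_of_lt_mul hl⟩
  refine Eq.trans ?_ this
  simp only [Finset.sum_apply, Pi.smul_apply, hs, smul_eq_mul]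
  refine Finset.sum_congr rfl fun u _ => ?_
  rw [← pow_mul, ← pow_add, Nat.mod_add_div]

end Tensor3

/-! ### Slice spaces without rank-one matrices -/

/-- The set of matrices of rank at most one is cut out by the `2 × 2` minors. -/
theorem isClosed_setOf_outer (m n : ℕ) :
    IsClosed {M : Fin m → Fin n → ℝ | ∃ (x : Fin m → ℝ) (y : Fin n → ℝ),
      M = fun i j => x i * y j} := by
  have : {M : Fin m → Fin n → ℝ | ∃ (x : Fin m → ℝ) (y : Fin n → ℝ), M = fun i j => x i * y j} =
      {M | ∀ i i' j j', M i j * M i' j' = M i j' * M i' j} := by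
    ext M
    constructor
    · rintro ⟨x, y, rfl⟩ i i' j j'
      ring
    · intro h
      by_cases h0 : ∃ i j, M i j ≠ 0
      · obtain ⟨i₀, j₀, h0⟩ := h0
        refine ⟨fun i => M i j₀ / M i₀ j₀, M i₀, ?_⟩
        funext i j
        rw [div_mul_eq_mul_div, eq_div_iff h0]
        exact h i i₀ j j₀
      · push Not at h0
        exact ⟨0, 0, by funext i j; simp [h0]⟩
  rw [this]
  simp only [Set.ofPred_forall]
  exact isClosed_iInter fun i => isClosed_iInter fun i' => isClosed_iInter fun j =>
    isClosed_iInter fun j' => isClosed_eq (by fun_prop) (by fun_prop)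

/-- A subspace of matrices of dimension `p` without rank-one matrices. -/
theorem exists_linearIndependent_no_outer {m n p : ℕ} (hm : 0 < m) (hmn : m ≤ hurwitzRadon n)
    (hp : p ≤ (m - 1) * n) :
    ∃ v : Fin p → Fin m → Fin n → ℝ, ∀ c : Fin p → ℝ, c ≠ 0 →
      ¬ ∃ (x : Fin m → ℝ) (y : Fin n → ℝ), ∑ k, c k • v k = fun i j => x i * y j := by
  obtain ⟨B, hB⟩ := exists_nonsingular_bilinear hm hmn
  -- The linearization of the bilinear map: `φ` sends the outer product of `x` and `y` to its value
  -- at `(x, y)`.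
  let φ : (Fin m → Fin n → ℝ) →ₗ[ℝ] (Fin n → ℝ) :=
    ∑ i, (B i).mulVecLin ∘ₗ LinearMap.proj i
  have hφ : ∀ M, φ M = ∑ i, (B i).mulVec (M i) := fun M => by simp [φ]
  have hdim : p ≤ Module.finrank ℝ (LinearMap.ker φ) := by
    have h1 := φ.finrank_range_add_finrank_ker
    have h2 := Submodule.finrank_le (LinearMap.range φ)
    simp only [Module.finrank_fintype_fun_eq_card, Fintype.card_fin, Module.finrank_pi_fintype,
      Finset.sum_const, Finset.card_univ, smul_eq_mul] at h1 h2
    rw [Nat.sub_mul, one_mul] at hp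
    have : n ≤ m * n := Nat.le_mul_of_pos_left n hm
    omega
  obtain ⟨v, hv⟩ := exists_linearIndependent_of_le_finrank hdim
  refine ⟨fun k => v k, fun c hc ⟨x, y, hxy⟩ => hc ?_⟩
  have hker : φ (fun i j => x i * y j) = 0 := by
    rw [← hxy, map_sum]
    refine Finset.sum_eq_zero fun k _ => ?_
    rw [map_smul, LinearMap.mem_ker.1 (v k).2, smul_zero]
  have hxy0 : (fun i j => x i * y j) = (0 : Fin m → Fin n → ℝ) := by
    rw [hφ] at hker
    have : (∑ i, x i • B i).mulVec y = 0 := by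
      rw [← hker, Matrix.sum_mulVec]
      refine Finset.sum_congr rfl fun i _ => ?_
      rw [Matrix.smul_mulVec, ← Matrix.mulVec_smul]
      rfl
    rcases hB x y this with rfl | rfl <;> funext i j <;> simp
  rw [hxy0] at hxy
  have hsum : ∑ k, c k • v k = 0 := Subtype.ext (by simpa using hxy)
  exact funext (Fintype.linearIndependent_iff.1 hv c hsum)

namespace Tensor3

variable {m n p : ℕ}

/-- If no nonzero combination of the `p` slices has rank at most one, then the rank exceeds
`p`. -/
theorem lt_of_isSumOfPure {T : Tensor3 ℝ m n p} (hp : 0 < p)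
    (hT : ∀ c : Fin p → ℝ, c ≠ 0 →
      ¬ ∃ (x : Fin m → ℝ) (y : Fin n → ℝ), ∑ k, c k • T.slice k = fun i j => x i * y j)
    {r : ℕ} (h : T.IsSumOfPure r) : p < r := by
  have hli : LinearIndependent ℝ T.slice := by
    rw [Fintype.linearIndependent_iff]
    intro c hc
    by_contra hne
    push Not at hne
    obtain ⟨k, hk⟩ := hne
    exact hT c (fun h0 => hk (congrFun h0 k)) ⟨0, 0, by rw [hc]; funext i j; simp⟩
  refine lt_of_le_of_ne (h.le_of_linearIndependent hli) fun hpr => ?_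
  subst hpr
  obtain ⟨a, b, hle⟩ := h.span_slice_le
  -- With `r = p` the two spans coincide, so each summand `a u ⊗ b u` lies in the slice span and
  -- must vanish.
  have heq := Submodule.eq_of_le_of_finrank_le hle (by
    rw [finrank_span_eq_card hli]
    exact finrank_range_le_card _)
  have hu : ∀ u, (fun i j => a u i * b u j) = 0 := by
    intro u
    have hmem : (fun i j => a u i * b u j) ∈ Submodule.span ℝ (Set.range T.slice) := by
      rw [heq]
      exact Submodule.subset_span ⟨u, rfl⟩
    obtain ⟨c, hc⟩ := (Submodule.mem_span_range_iff_exists_fun ℝ).1 hmem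
    have hc0 : c = 0 := by
      by_contra hne
      exact hT c hne ⟨_, _, hc⟩
    rw [← hc, hc0]
    simp
  have hbot : Submodule.span ℝ (Set.range T.slice) = ⊥ := by
    rw [heq, Submodule.span_eq_bot]
    rintro _ ⟨u, rfl⟩
    exact hu u
  have hrank := finrank_span_eq_card hli
  rw [hbot, finrank_bot, Fintype.card_fin] at hrank
  omega

/-- Having no nonzero combination of slices of rank at most one is an open condition. -/
theorem eventually_no_outer {T₀ : Tensor3 ℝ m n p}
    (hT : ∀ c : Fin p → ℝ, c ≠ 0 →
      ¬ ∃ (x : Fin m → ℝ) (y : Fin n → ℝ), ∑ k, c k • T₀.slice k = fun i j => x i * y j) :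
    ∀ᶠ T : Tensor3 ℝ m n p in nhds T₀, ∀ c : Fin p → ℝ, c ≠ 0 →
      ¬ ∃ (x : Fin m → ℝ) (y : Fin n → ℝ), ∑ k, c k • T.slice k = fun i j => x i * y j := by
  have hcont : Continuous fun z : Tensor3 ℝ m n p × (Fin p → ℝ) => ∑ k, z.2 k • z.1.slice k := by
    unfold slice
    fun_prop
  have h1 := (isCompact_sphere (0 : Fin p → ℝ) 1).eventually_forall_of_forall_eventually
    (x₀ := T₀) (P := fun T c =>
      ¬ ∃ (x : Fin m → ℝ) (y : Fin n → ℝ), ∑ k, c k • T.slice k = fun i j => x i * y j)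
    fun c hc => ((isClosed_setOf_outer m n).isOpen_compl.preimage hcont).mem_nhds
      (hT c (ne_zero_of_mem_unit_sphere ⟨c, hc⟩))
  filter_upwards [h1] with T h c hc ⟨x, y, hxy⟩
  refine h (‖c‖⁻¹ • c) (by simp [norm_smul, hc]) ⟨‖c‖⁻¹ • x, y, ?_⟩
  simp only [Pi.smul_apply, smul_eq_mul, mul_smul]
  rw [← Finset.smul_sum, hxy]
  funext i j
  simp [mul_assoc]

end Tensor3

/-! ### Typical ranks -/

instance (m n p : ℕ) : (volume : Measure (Tensor3 ℝ m n p)).IsOpenPosMeasure :=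
  haveI : (volume : Measure (Fin n → Fin p → ℝ)).IsOpenPosMeasure :=
    Measure.pi.isOpenPosMeasure _
  Measure.pi.isOpenPosMeasure _

theorem mem_typicalRanks_of_isOpen {m n p r : ℕ} {U : Set (Tensor3 ℝ m n p)} (hU : IsOpen U)
    (hne : U.Nonempty) (h : ∀ T ∈ U, T.rank = r) : r ∈ typicalRanks m n p :=
  ⟨U, hU.measurableSet.nullMeasurableSet, hU.measure_pos volume hne, h⟩

/-- The number of slices is a typical rank in the given range. -/
theorem self_mem_typicalRanks {d e p : ℕ} (hd : d ≠ 0) (hp₁ : d * e + 1 ≤ p)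
    (hp₂ : p ≤ d * (e + 1)) : p ∈ typicalRanks (d + 1) (e + 1) p := by
  -- Nonnegative nodes keep `t u ^ d` injective for even `d` too.
  set t : Fin p → ℝ := fun u => (u : ℕ) with ht'
  have ht : Function.Injective t := fun a b h => Fin.ext (by simpa [t] using h)
  have htd : Function.Injective fun u => t u ^ d := fun a b h =>
    ht ((pow_left_inj₀ (by simp [t]) (by simp [t]) hd).1 h)
  set x := Tensor3.curvePoint d (e + 1) p t
  have h1 := (Tensor3.contDiff_sumPure.hasStrictFDerivAt (x := x)
    one_ne_zero).map_nhds_eq_of_surj (Tensor3.range_fderiv_sumPure_curvePoint ht htd hp₁)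
  have h2 : {T : Tensor3 ℝ (d + 1) (e + 1) p | T.IsSumOfPure p} ∈ nhds (Tensor3.sumPure x) := by
    rw [← h1, Tensor3.setOf_isSumOfPure]
    exact Filter.range_mem_map
  obtain ⟨U, hUs, hU, hxU⟩ := mem_nhds_iff.1 (Filter.inter_mem h2
    ((Tensor3.isOpen_linearIndependent_slice _ _ _).mem_nhds
      (Tensor3.linearIndependent_slice_curvePoint ht hp₂)))
  refine mem_typicalRanks_of_isOpen hU ⟨_, hxU⟩ fun T hT => (Tensor3.rank_eq_iff T p).2
    ⟨(hUs hT).1, fun s hs h => ?_⟩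
  exact absurd (h.le_of_linearIndependent (hUs hT).2) (not_le.2 hs)

/-- Some typical rank is larger than the number of slices when `m ≤ ρ(n)`. -/
theorem exists_mem_typicalRanks_gt {m n p : ℕ} (hm : 0 < m) (hmn : m ≤ hurwitzRadon n)
    (hp₀ : 0 < p) (hp : p ≤ (m - 1) * n) : ∃ r ∈ typicalRanks m n p, p < r := by
  obtain ⟨v, hv⟩ := exists_linearIndependent_no_outer hm hmn hp
  obtain ⟨U, hUs, hU, hvU⟩ := mem_nhds_iff.1
    (Tensor3.eventually_no_outer (T₀ := fun i j k => v k i j) hv)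
  have hr : ∃ r, volume (U ∩ {T : Tensor3 ℝ m n p | T.rank = r}) ≠ 0 := by
    by_contra hall
    push Not at hall
    refine (hU.measure_pos volume ⟨_, hvU⟩).ne' (measure_mono_null ?_ (measure_iUnion_null hall))
    exact fun T hT => Set.mem_iUnion.2 ⟨T.rank, hT, rfl⟩
  obtain ⟨r, hr⟩ := hr
  refine ⟨r, ⟨_, (hU.measurableSet.inter
    (Tensor3.measurableSet_rank_eq m n p r)).nullMeasurableSet, hr.bot_lt, fun T hT => hT.2⟩, ?_⟩
  obtain ⟨T, hTU, hTr⟩ := nonempty_of_measure_ne_zero hr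
  exact Tensor3.lt_of_isSumOfPure hp₀ (hUs hTU) ((Tensor3.rank_eq_iff T r).1 hTr).1

theorem mainTheorem1 (m n p : ℕ) (hn : 0 < n) (hm : 3 ≤ m) (hmn : m ≤ hurwitzRadon n)
    (hp₁ : (m - 1) * (n - 1) + 1 ≤ p) (hp₂ : p ≤ (m - 1) * n) :
    2 ≤ (typicalRanks m n p).encard ∧
      p ∈ typicalRanks m n p ∧ ∃ r ∈ typicalRanks m n p, p < r := by
  obtain ⟨r, hr, hpr⟩ := exists_mem_typicalRanks_gt (by omega) hmn (by omega) hp₂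
  have hp : p ∈ typicalRanks m n p := by
    obtain ⟨d, rfl⟩ : ∃ d, m = d + 1 := ⟨m - 1, by omega⟩
    obtain ⟨e, rfl⟩ : ∃ e, n = e + 1 := ⟨n - 1, by omega⟩
    exact self_mem_typicalRanks (by omega) hp₁ hp₂
  refine ⟨?_, hp, r, hr, hpr⟩
  rw [← Set.encard_pair hpr.ne]
  exact Set.encard_le_encard (Set.insert_subset hp (Set.singleton_subset_iff.2 hr))
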